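/- Let $d\in\mathbb N$ and let $\Phi$ be the distribution function of the univariate standard Gaussian law. Let $\mathbf u_0=(u_0^1,\dots,u_0^d)$ be a random vector whose law is a copula, i.e. each $u_0^i$ is $\mathrm{Uniform}(0,1)$ (the joint law is otherwise arbitrary), and let $z_0^i=\Phi^{-1}(u_0^i)$ for $i=1,\dots,d$. Let $\mathbf B$ be a standard $d$-dimensional Brownian motion independent of $\mathbf z_0=(z_0^1,\dots,z_0^d)$, and let $\mathbf z=(\mathbf z_t)_{t\ge0}$ be a continuous solution, started from $\mathbf z_0$, of $$d\mathbf z_t=-\mathbf z_t\,dt+\sqrt2\,d\mathbf B_t .$$ Put $u_t^i=\Phi(z_t^i)$. Then $$u_t^i\sim \mathrm{Uniform}(0,1)\qquad\text{for all } t\ge0,\ i\in\{1,\dots,d\}.$$ Moreover, for every $t\ge0$ the law of $\mathbf z_t$ has a unique copula $c_t$ (in the sense of Sklar's theorem: the probability law on $[0,1]^d$ with uniform marginals whose distribution function $C_t$ satisfies $\mathbb P(z_t^1\le x^1,\dots,z_t^d\le x^d)=C_t(P_t^1(x^1),\dots,P_t^d(x^d))$ for all $x\in\mathbb R^d$, where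 $P_t^i$ is the distribution function of $z_t^i$), and $c_t$ converges, as $t\to\infty$, to the independence copula (the uniform law on $[0,1]^d$) in Kullback–Leibler divergence with rate $\mathcal O(e^{-2t})$: there are constants $K$ and $T$ such that $$\mathrm{KL}\bigl(c_t\,\|\,\mathrm{Uniform}([0,1]^d)\bigr)\le K e^{-2t}\qquad\text{for all } t\ge T .$$ -/

import Mathlib

open MeasureTheory ProbabilityTheory Filter Topology
open scoped ENNReal NNReal

noncomputable section

/-- The standard normal distribution function `Φ`. -/
def stdNormalCDF (x : ℝ) : ℝ := cdf (gaussianReal 0 1) x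

/-- The quantile function `Φ⁻¹` of the standard normal law, i.e. the inverse of
`Φ : ℝ → (0, 1)`; the values at `u ≤ 0` and `u ≥ 1` are irrelevant. -/
def stdNormalQuantile (u : ℝ) : ℝ := sInf {x : ℝ | u ≤ stdNormalCDF x}

/-- The uniform distribution `U(0, 1)` on the real line. -/
def uniform01 : Measure ℝ := volume.restrict (Set.Ioo 0 1)

/-- A `d`-dimensional copula: a probability distribution on `ℝ^d` whose marginals are all
`U(0, 1)` (so that it is carried by the unit cube). -/
structure IsCopula {d : ℕ} (C : Measure (Fin d → ℝ)) : Prop where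
  isProbabilityMeasure : IsProbabilityMeasure C
  map_eval : ∀ i, C.map (fun u => u i) = uniform01

/-- `C` is a copula of the distribution `μ` on `ℝ^d`, in the sense of Sklar's theorem: it is a
copula, and its joint distribution function, evaluated at the marginal distribution functions
of `μ`, gives the joint distribution function of `μ`.
Here `Set.Iic x` is the orthant `{y | ∀ i, y i ≤ x i}`. -/
structure IsCopulaOf {d : ℕ} (C μ : Measure (Fin d → ℝ)) : Prop where
  isCopula : IsCopula C
  sklar : ∀ x : Fin d → ℝ,
    μ (Set.Iic x) = C (Set.Iic fun i => cdf (μ.map (fun y => y i)) (x i))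

/-- The independence copula: the uniform distribution on the unit cube. -/
def independenceCopula (d : ℕ) : Measure (Fin d → ℝ) := Measure.pi fun _ => uniform01

/-- `B` is a standard `d`-dimensional Brownian motion: its components are independent standard
real Brownian motions (with almost surely continuous paths). -/
structure IsBrownianMotion {d : ℕ} {Ω : Type*} [MeasurableSpace Ω]
    (B : ℝ≥0 → Ω → Fin d → ℝ) (P : Measure Ω) : Prop where
  isBrownianReal : ∀ i, IsBrownianReal (fun t ω => B t ω i) P
  iIndepFun : iIndepFun (fun i ω (t : ℝ≥0) => B t ω i) P

/-- `z` is a solution of the stochastic differential equation `dz = - z dt + √2 dB`, driven by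
the standard Brownian motion `B`, with an initial value `z 0` independent of `B`. As the noise is
additive, the equation in integral form is
`z_t = z_0 - ∫₀ᵗ z_s ds + √2 B_t` for all `t ≥ 0`, almost surely. -/
structure IsOUProcess {d : ℕ} {Ω : Type*} [MeasurableSpace Ω]
    (z B : ℝ≥0 → Ω → Fin d → ℝ) (P : Measure Ω) : Prop where
  isBrownianMotion : IsBrownianMotion B P
  aemeasurable : ∀ t, AEMeasurable (z t) P
  indepFun : IndepFun (z 0) (fun ω t => B t ω) P
  continuous : ∀ᵐ ω ∂P, Continuous fun t => z t ω
  sde : ∀ᵐ ω ∂P, ∀ (t : ℝ≥0) (i : Fin d),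
    z t ω i = z 0 ω i - (∫ s in (0 : ℝ)..(t : ℝ), z s.toNNReal ω i) + √2 * B t ω i

end

/-! Variation of constants gives z_t = e^{-t} z_0 + N_t (`IsOUProcess.ae_eq`), where N_t has
independent N(0, 1 - e^{-2t}) coordinates and is independent of z_0 (`IsOUProcess.hasLaw_prod`). The
variances e^{-2t} and 1 - e^{-2t} add up to 1, so the marginals stay standard normal. Hence Φ(z_t^i)
is uniform, and the only copula of z_t is the law of Φ(z_t), taken coordinatewise.

For the rate, the law of z_t is a mixture with no tractable density, so the pair (z_0, z_t) is used
instead. Let γ be the standard Gaussian law on ℝ^d. Given z_0, the law of z_t is Gaussian, so the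
pair has an explicit density with respect to law(z_0) ⊗ γ, however singular law(z_0) is. Its
expected logarithm involves only second moments of single coordinates and equals -(d/2) log(1 -
e^{-2t}), whatever the initial copula (`IsOUProcess.klDiv_joint`). The map (x, y) ↦ Φ(y) sends the
two laws to c_t and the independence copula, so data processing bounds KL(c_t) by this number, which
is at most d e^{-2t} once e^{-2t} ≤ 1/2.

N_t is built pathwise: integration by parts makes its approximating sums converge along every
continuous path started at 0. -/

/-! ### Riemann sums and the linear integral equation. -/

/-- Riemann–Stieltjes sums along the uniform partition of `[0, t]`. -/
lemma tendsto_sum_integral_mul_tag {F g : ℝ → ℝ} (hF : Continuous F) (hg : Continuous g)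
    {t : ℝ} (ht : 0 ≤ t) {τ : ℕ → ℕ → ℝ}
    (hτ : ∀ n k : ℕ, k < n → τ n k ∈ Set.Icc (k / n * t) ((k + 1 : ℕ) / n * t)) :
    Tendsto (fun n : ℕ => ∑ k ∈ Finset.range n,
        (∫ s in (k / n * t)..((k + 1 : ℕ) / n * t), g s) * F (τ n k))
      atTop (𝓝 (∫ s in 0..t, g s * F s)) := by
  obtain ⟨C, hC⟩ : ∃ C, ∀ s ∈ Set.Icc 0 t, |g s| ≤ C := by
    obtain ⟨C, hC⟩ := isCompact_Icc.exists_bound_of_continuousOn (s := Set.Icc 0 t) hg.continuousOn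
    exact ⟨C, fun s hs => hC s hs⟩
  have hC0 : 0 ≤ C := (abs_nonneg _).trans (hC 0 ⟨le_rfl, ht⟩)
  rw [Metric.tendsto_atTop]
  intro ε hε
  obtain ⟨η, hη, hηε⟩ : ∃ η > 0, C * η * t < ε := by
    -- The `+ 1` keeps the denominator positive when `C * t = 0`.
    refine ⟨ε / (2 * (C * t + 1)), by positivity, ?_⟩
    have h : 0 ≤ C * t := by positivity
    rw [show C * (ε / (2 * (C * t + 1))) * t = ε * (C * t / (2 * (C * t + 1))) by ring]
    have : C * t / (2 * (C * t + 1)) < 1 := by rw [div_lt_one (by positivity)]; linarith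
    nlinarith
  obtain ⟨δ, hδ, hFδ⟩ := Metric.uniformContinuousOn_iff.1
    (isCompact_Icc.uniformContinuousOn_of_continuous (s := Set.Icc 0 t) hF.continuousOn) η hη
  obtain ⟨N, hN⟩ := exists_nat_gt (t / δ)
  refine ⟨N + 1, fun n hn => ?_⟩
  have hn0 : (0 : ℝ) < n := by exact_mod_cast (by omega : 0 < n)
  have hmesh : t / n < δ := by
    rw [div_lt_comm₀ hn0 hδ]
    exact hN.trans_le (by exact_mod_cast (by omega : N ≤ n))
  have hstep (k : ℕ) : ((k + 1 : ℕ) : ℝ) / n * t - k / n * t = t / n := by push_cast; ring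
  have hle (k : ℕ) : (k : ℝ) / n * t ≤ ((k + 1 : ℕ) : ℝ) / n * t := by
    have := hstep k
    have : 0 ≤ t / n := by positivity
    linarith
  have hsplit : ∫ s in 0..t, g s * F s =
      ∑ k ∈ Finset.range n, ∫ s in (k / n * t)..((k + 1 : ℕ) / n * t), g s * F s := by
    rw [intervalIntegral.sum_integral_adjacent_intervals (a := fun k : ℕ => (k : ℝ) / n * t)]
    · simp [hn0.ne']
    · intro k _
      exact (hg.mul hF).intervalIntegrable _ _
  rw [hsplit, dist_eq_norm, ← Finset.sum_sub_distrib]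
  have hterm : ∀ k ∈ Finset.range n,
      ‖(∫ s in (k / n * t)..((k + 1 : ℕ) / n * t), g s) * F (τ n k) -
        ∫ s in (k / n * t)..((k + 1 : ℕ) / n * t), g s * F s‖ ≤ C * η * (t / n) := by
    intro k hk
    have hkn : k < n := Finset.mem_range.1 hk
    rw [← intervalIntegral.integral_mul_const, ← intervalIntegral.integral_sub
      (by apply Continuous.intervalIntegrable; fun_prop)
      (by apply Continuous.intervalIntegrable; fun_prop)]
    have hk0 : 0 ≤ (k : ℝ) / n * t := by positivity
    have hk1 : ((k + 1 : ℕ) : ℝ) / n * t ≤ t := by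
      have : ((k + 1 : ℕ) : ℝ) / n ≤ 1 := (div_le_one hn0).2 (by exact_mod_cast hkn)
      nlinarith
    have := intervalIntegral.norm_integral_le_of_norm_le_const (C := C * η)
      (a := k / n * t) (b := ((k + 1 : ℕ) : ℝ) / n * t)
      (f := fun s => g s * F (τ n k) - g s * F s) fun s hs => by
        rw [Set.uIoc_of_le (hle k)] at hs
        have hτk := hτ n k hkn
        rw [← mul_sub, norm_mul]
        have hs' : s ∈ Set.Icc 0 t := ⟨hk0.trans hs.1.le, hs.2.trans hk1⟩
        refine mul_le_mul (hC s hs') ?_ (norm_nonneg _) hC0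
        refine (hFδ (τ n k) ⟨hk0.trans hτk.1, hτk.2.trans hk1⟩ s hs' ?_).le
        rw [Real.dist_eq, abs_lt]
        have := hstep k
        constructor <;> linarith [hτk.1, hτk.2, hs.1, hs.2]
    rwa [hstep, abs_of_nonneg (by positivity)] at this
  calc _ ≤ ∑ k ∈ Finset.range n, C * η * (t / n) := norm_sum_le_of_le _ hterm
    _ = C * η * t := by
      rw [Finset.sum_const, Finset.card_range, nsmul_eq_mul]
      field_simp
    _ < ε := hηε

/-- The solution of the linear equation `x = x₀ - ∫ x + β` by variation of constants. -/
lemma eq_of_eq_sub_integral_add {x β : ℝ → ℝ} {x₀ : ℝ} (hx : Continuous x) (hβ : Continuous β)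
    (h : ∀ t, 0 ≤ t → x t = x₀ - (∫ s in 0..t, x s) + β t) {t : ℝ} (ht : 0 ≤ t) :
    x t = Real.exp (-t) * x₀ + (β t - ∫ s in 0..t, Real.exp (s - t) * β s) := by
  -- Integrating factor: by the equation, this derivative is `exp s * (x₀ + β s)` on `[0, t]`, free
  -- of `x`.
  have hderiv : ∀ s : ℝ, HasDerivAt (fun r => Real.exp r * ∫ u in 0..r, x u)
      (Real.exp s * (∫ u in 0..s, x u) + Real.exp s * x s) s := fun s =>
    (Real.hasDerivAt_exp s).mul (intervalIntegral.integral_hasDerivAt_right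
      (hx.intervalIntegrable _ _) (hx.stronglyMeasurableAtFilter _ _) hx.continuousAt)
  have hprim : Continuous fun r => ∫ u in 0..r, x u :=
    intervalIntegral.continuous_primitive (fun _ _ => hx.intervalIntegrable _ _) 0
  have hFTC := intervalIntegral.integral_eq_sub_of_hasDerivAt (a := 0) (b := t)
    (fun s _ => hderiv s) (by apply Continuous.intervalIntegrable; fun_prop)
  have hcongr : ∫ s in 0..t, (Real.exp s * (∫ u in 0..s, x u) + Real.exp s * x s) =
      ∫ s in 0..t, (Real.exp s * x₀ + Real.exp s * β s) := by
    refine intervalIntegral.integral_congr fun s hs => ?_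
    rw [Set.uIcc_of_le ht] at hs
    rw [h s hs.1]
    ring
  have hexp : ∫ s in 0..t, Real.exp s * x₀ = (Real.exp t - 1) * x₀ := by
    rw [intervalIntegral.integral_mul_const, integral_exp, Real.exp_zero]
  rw [hcongr, intervalIntegral.integral_add (by apply Continuous.intervalIntegrable; fun_prop)
    (by apply Continuous.intervalIntegrable; fun_prop), hexp] at hFTC
  have hscale : ∫ s in 0..t, Real.exp (s - t) * β s =
      Real.exp (-t) * ∫ s in 0..t, Real.exp s * β s := by
    rw [← intervalIntegral.integral_const_mul]
    congr 1 with s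
    rw [sub_eq_add_neg, Real.exp_add]
    ring
  have hinv : Real.exp (-t) * Real.exp t = 1 := by rw [← Real.exp_add]; simp
  simp only [intervalIntegral.integral_same, mul_zero, sub_zero] at hFTC
  rw [h t ht, hscale]
  linear_combination Real.exp (-t) * hFTC + ((∫ s in 0..t, x s) - x₀) * hinv

/-! ### The stochastic convolution as a pathwise limit. -/

/-- Riemann–Stieltjes sums of `∫₀ᵗ exp (s - t) db_s` along the uniform partition of `[0, t]`. -/
noncomputable def ouSum (t : ℝ≥0) (n : ℕ) (b : ℝ≥0 → ℝ) : ℝ :=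
  ∑ k ∈ Finset.range n, Real.exp (((k + 1 : ℕ) : ℝ) / n * t - t) *
    (b (((k + 1 : ℕ) : ℝ≥0) / n * t) - b ((k : ℝ≥0) / n * t))

lemma sum_range_mul_sub (e b : ℕ → ℝ) (n : ℕ) :
    ∑ k ∈ Finset.range n, e (k + 1) * (b (k + 1) - b k) =
      e n * b n - e 0 * b 0 - ∑ k ∈ Finset.range n, (e (k + 1) - e k) * b k := by
  rw [eq_sub_iff_add_eq, ← Finset.sum_add_distrib, ← Finset.sum_range_sub (fun k => e k * b k)]
  exact Finset.sum_congr rfl fun k _ => by ring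

/-- Summation by parts moves the increments from `b` to the smooth exponential, so continuity of `b`
suffices and no bound on its variation is needed. -/
lemma tendsto_ouSum {b : ℝ≥0 → ℝ} (hb : Continuous b) (hb0 : b 0 = 0) (t : ℝ≥0) :
    Tendsto (fun n => ouSum t n b) atTop
      (𝓝 (b t - ∫ s in (0 : ℝ)..t, Real.exp (s - t) * b s.toNNReal)) := by
  have hcont : Continuous fun s : ℝ => b s.toNNReal := hb.comp continuous_real_toNNReal
  have hlim := tendsto_sum_integral_mul_tag (g := fun s => Real.exp (s - t)) hcont
    (by fun_prop) t.coe_nonneg (τ := fun n k => k / n * t) fun n k hk => ⟨le_rfl, by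
      have : (0 : ℝ) ≤ t := t.coe_nonneg
      have hk' : (k : ℝ) ≤ ((k + 1 : ℕ) : ℝ) := by exact_mod_cast k.le_succ
      gcongr⟩
  refine (tendsto_const_nhds.sub hlim).congr' ?_
  -- At `n = 0` the endpoint `n / n * t` would be `0` rather than `t`.
  filter_upwards [eventually_gt_atTop 0] with n hn
  have hn0 : (n : ℝ) ≠ 0 := by exact_mod_cast hn.ne'
  have hn0' : (n : ℝ≥0) ≠ 0 := by exact_mod_cast hn.ne'
  rw [ouSum, sum_range_mul_sub (fun k => Real.exp ((k : ℝ) / n * t - t))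
    (fun k => b ((k : ℝ≥0) / n * t))]
  simp only [div_self hn0, div_self hn0', one_mul, sub_self, Real.exp_zero, Nat.cast_zero,
    zero_div, zero_mul, hb0, mul_zero, sub_zero]
  congr 1
  refine Finset.sum_congr rfl fun k _ => ?_
  have hk : ((k : ℝ) / n * t).toNNReal = (k : ℝ≥0) / n * t := by
    rw [← Real.toNNReal_coe (r := (k : ℝ≥0) / n * t)]
    simp
  rw [intervalIntegral.integral_comp_sub_right (fun s => Real.exp s), integral_exp]
  exact congrArg₂ (· * ·) rfl (congrArg b hk)

lemma measurable_ouSum (t : ℝ≥0) (n : ℕ) : Measurable (ouSum t n) := by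
  unfold ouSum
  fun_prop

/-- The variance of `ouSum t n` along a Brownian path. -/
noncomputable def ouSumVar (t : ℝ≥0) (n : ℕ) : ℝ :=
  ∑ k ∈ Finset.range n, Real.exp (((k + 1 : ℕ) : ℝ) / n * t - t) ^ 2 * (t / n)

lemma tendsto_ouSumVar (t : ℝ≥0) :
    Tendsto (ouSumVar t) atTop (𝓝 ((1 - Real.exp (-2 * t)) / 2)) := by
  have hle (n k : ℕ) : (k : ℝ) / n * t ≤ ((k + 1 : ℕ) : ℝ) / n * t := by
    have hk : (k : ℝ) ≤ ((k + 1 : ℕ) : ℝ) := by exact_mod_cast k.le_succ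
    gcongr
  have hlim := tendsto_sum_integral_mul_tag (F := fun s => Real.exp (s - t) ^ 2)
    (g := fun _ => 1) (by fun_prop) (by fun_prop) t.coe_nonneg
    (τ := fun n k => ((k + 1 : ℕ) : ℝ) / n * t) fun n k _ => ⟨hle n k, le_rfl⟩
  have hval : ∫ s in (0 : ℝ)..t, (1 : ℝ) * Real.exp (s - t) ^ 2 =
      (1 - Real.exp (-2 * t)) / 2 := by
    have h (s : ℝ) : (1 : ℝ) * Real.exp (s - t) ^ 2 = Real.exp (2 * s - 2 * t) := by
      rw [one_mul, ← Real.exp_nat_mul]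
      congr 1
      push_cast
      ring
    simp_rw [h]
    rw [intervalIntegral.integral_comp_mul_sub (fun s => Real.exp s) two_ne_zero, integral_exp]
    simp
    ring
  rw [← hval]
  refine hlim.congr fun n => Finset.sum_congr rfl fun k _ => ?_
  rw [intervalIntegral.integral_const, smul_eq_mul, mul_one, mul_comm]
  congr 1
  push_cast
  ring

/-! ### Gaussian law of the noise. -/

section Noise

variable {Ω : Type*} [MeasurableSpace Ω] {P : Measure Ω}

lemma aemeasurable_ouSum {b : ℝ≥0 → Ω → ℝ} (hb : ∀ t, AEMeasurable (b t) P) (t : ℝ≥0) (n : ℕ) :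
    AEMeasurable (fun ω => ouSum t n fun s => b s ω) P := by
  unfold ouSum
  fun_prop

lemma charFun_map_ouSum {b : ℝ≥0 → Ω → ℝ} (hb : IsPreBrownianReal b P) (t : ℝ≥0)
    (n : ℕ) (u : ℝ) :
    charFun (P.map fun ω => ouSum t n fun s => b s ω) u =
      Complex.exp ((-(ouSumVar t n * u ^ 2 / 2) : ℝ) : ℂ) := by
  have hmeas := hb.aemeasurable
  have hmono : Monotone fun k : ℕ => (k : ℝ≥0) / n * t := fun j k hjk => by
    have : (j : ℝ≥0) ≤ k := by exact_mod_cast hjk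
    dsimp only
    gcongr
  have hind := (hb.hasIndepIncrements.nat hmono).comp
    (fun k x => Real.exp (((k + 1 : ℕ) : ℝ) / n * t - t) * x) (fun k => by fun_prop)
  have hchar := (hind.restrict (Finset.range n)).charFun_map_fun_finsetSum_eq_prod
    (s := Finset.range n) fun k _ => by
      simp only [Function.comp_def]
      fun_prop
  have hfun : (fun ω => ouSum t n fun s => b s ω) = fun ω => ∑ k ∈ Finset.range n,
      ((fun x => Real.exp (((k + 1 : ℕ) : ℝ) / n * t - t) * x) ∘
        fun ω => b (((k + 1 : ℕ) : ℝ≥0) / n * t) ω - b ((k : ℝ≥0) / n * t) ω) ω := rfl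
  rw [hfun, hchar, Finset.prod_apply, ouSumVar, Finset.sum_mul, Finset.sum_div,
    ← Finset.sum_neg_distrib, Complex.ofReal_sum, Complex.exp_sum]
  refine Finset.prod_congr rfl fun k _ => ?_
  have hlaw := gaussianReal_const_mul (hb.hasLaw_sub (((k + 1 : ℕ) : ℝ≥0) / n * t)
    ((k : ℝ≥0) / n * t)) (Real.exp (((k + 1 : ℕ) : ℝ) / n * t - t))
  have hmap := hlaw.map_eq
  simp only [Pi.sub_apply] at hmap
  simp only [Function.comp_def]
  rw [hmap, charFun_gaussianReal]
  have hdist : ((nndist ((((k + 1 : ℕ) : ℝ≥0) / n * t).1) (((k : ℝ≥0) / n * t).1) : ℝ≥0) : ℝ) =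
      t / n := by
    rw [coe_nndist, Real.dist_eq]
    have : (((((k + 1 : ℕ) : ℝ≥0) / n * t : ℝ≥0) : ℝ) - (((k : ℝ≥0) / n * t : ℝ≥0) : ℝ)) =
        t / n := by
      push_cast
      ring
    exact (congrArg abs this).trans (abs_of_nonneg (by positivity))
  rw [NNReal.coe_mul, hdist]
  push_cast
  simp

/-- The stochastic integral `∫₀ᵗ exp (s - t) db_s` as a measurable function of the path `b`. -/
noncomputable def ouNoise (t : ℝ≥0) (b : ℝ≥0 → ℝ) : ℝ := limsup (fun n => ouSum t n b) atTop

lemma measurable_ouNoise (t : ℝ≥0) : Measurable (ouNoise t) :=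
  Measurable.limsup (measurable_ouSum t)

lemma ouNoise_eq {b : ℝ≥0 → ℝ} (hb : Continuous b) (hb0 : b 0 = 0) (t : ℝ≥0) :
    ouNoise t b = b t - ∫ s in (0 : ℝ)..t, Real.exp (s - t) * b s.toNNReal :=
  (tendsto_ouSum hb hb0 t).limsup_eq

lemma tendsto_ouSum_ouNoise {b : ℝ≥0 → ℝ} (hb : Continuous b) (hb0 : b 0 = 0) (t : ℝ≥0) :
    Tendsto (fun n => ouSum t n b) atTop (𝓝 (ouNoise t b)) := by
  rw [ouNoise_eq hb hb0]
  exact tendsto_ouSum hb hb0 t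

lemma one_sub_exp_nonneg (t : ℝ≥0) : 0 ≤ 1 - Real.exp (-2 * t) := by
  rw [sub_nonneg, Real.exp_le_one_iff]
  linarith [t.coe_nonneg]

/-- The conditional variance `1 - exp (-2 t)` of the Ornstein-Uhlenbeck process. -/
noncomputable def ouVar (t : ℝ≥0) : ℝ≥0 := ⟨1 - Real.exp (-2 * t), one_sub_exp_nonneg t⟩

@[simp]
lemma coe_ouVar (t : ℝ≥0) : (ouVar t : ℝ) = 1 - Real.exp (-2 * t) := rfl

/-- An almost sure limit of centred Gaussians with convergent variances is Gaussian: characteristic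
functions pass to the limit by dominated convergence. The factor `√2` doubles the limiting variance
`(1 - exp (-2 t)) / 2`. -/
lemma hasLaw_sqrt_two_mul_ouNoise [IsProbabilityMeasure P] {b : ℝ≥0 → Ω → ℝ}
    (hb : IsBrownianReal b P) (t : ℝ≥0) :
    HasLaw (fun ω => √2 * ouNoise t fun s => b s ω) (gaussianReal 0 (ouVar t)) P := by
  have hlim : ∀ᵐ ω ∂P, Tendsto (fun n => ouSum t n fun s => b s ω) atTop
      (𝓝 (ouNoise t fun s => b s ω)) := by
    filter_upwards [hb.cont, hb.eval_zero_ae_eq_zero] with ω hω hω0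
    exact tendsto_ouSum_ouNoise hω hω0 t
  have hsum := aemeasurable_ouSum (P := P) hb.aemeasurable t
  have hmeas : AEMeasurable (fun ω => ouNoise t fun s => b s ω) P :=
    aemeasurable_of_tendsto_metrizable_ae' hsum hlim
  refine ⟨by fun_prop, ?_⟩
  have : IsProbabilityMeasure (P.map fun ω => √2 * ouNoise t fun s => b s ω) :=
    Measure.isProbabilityMeasure_map (by fun_prop)
  refine Measure.ext_of_charFun (funext fun u => ?_)
  rw [charFun_gaussianReal, charFun_apply_real, integral_map (by fun_prop) (by fun_prop)]
  have hleft : Tendsto (fun n => ∫ ω, Complex.exp ((u * √2 : ℝ) *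
      (ouSum t n fun s => b s ω : ℝ) * Complex.I) ∂P) atTop
      (𝓝 (∫ ω, Complex.exp (u * (√2 * ouNoise t fun s => b s ω : ℝ) * Complex.I) ∂P)) := by
    refine tendsto_integral_of_dominated_convergence (fun _ => 1) (fun n => ?_)
      (integrable_const 1) (fun n => ae_of_all _ fun ω => ?_) ?_
    · have := hsum n
      apply AEMeasurable.aestronglyMeasurable
      fun_prop
    · rw [← Complex.ofReal_mul, Complex.norm_exp_ofReal_mul_I]
    · filter_upwards [hlim] with ω hω
      have h := (Complex.continuous_ofReal.tendsto _).comp (hω.const_mul (u * √2))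
      refine ((Complex.continuous_exp.tendsto _).comp (h.mul_const Complex.I)).congr' ?_ |>.trans_eq ?_
      · exact Eventually.of_forall fun n => by simp
      · push_cast
        simp [mul_assoc]
  refine tendsto_nhds_unique hleft ?_
  have hn (n : ℕ) : ∫ ω, Complex.exp ((u * √2 : ℝ) *
      (ouSum t n fun s => b s ω : ℝ) * Complex.I) ∂P =
      Complex.exp ((-(ouSumVar t n * (u * √2) ^ 2 / 2) : ℝ) : ℂ) := by
    rw [← charFun_map_ouSum hb.toIsPreBrownianReal, charFun_apply_real,
      integral_map (hsum n) (by fun_prop)]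
  simp_rw [hn]
  have h2 : Tendsto (fun n => -(ouSumVar t n * (u * √2) ^ 2 / 2)) atTop
      (𝓝 (-((1 - Real.exp (-2 * t)) / 2 * (u * √2) ^ 2 / 2))) :=
    (((tendsto_ouSumVar t).mul_const _).div_const 2).neg
  have h3 := (Complex.continuous_exp.tendsto _).comp
    ((Complex.continuous_ofReal.tendsto _).comp h2)
  have hval : -((1 - Real.exp (-2 * t)) / 2 * (u * √2) ^ 2 / 2) = -(ouVar t * u ^ 2 / 2) := by
    rw [mul_pow, Real.sq_sqrt zero_le_two, coe_ouVar]
    ring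
  rw [hval] at h3
  convert h3 using 2
  congr 1
  push_cast
  simp

end Noise

/-! ### Explicit solution and laws of the Ornstein-Uhlenbeck process. -/

namespace IsOUProcess

variable {d : ℕ} {Ω : Type*} [MeasurableSpace Ω] {P : Measure Ω} {z B : ℝ≥0 → Ω → Fin d → ℝ}

lemma ae_eq (hz : IsOUProcess z B P) (t : ℝ≥0) :
    ∀ᵐ ω ∂P, ∀ i, z t ω i =
      Real.exp (-t) * z 0 ω i + √2 * ouNoise t fun s => B s ω i := by
  have hcont : ∀ᵐ ω ∂P, ∀ i, Continuous fun s => B s ω i :=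
    ae_all_iff.2 fun i => (hz.isBrownianMotion.isBrownianReal i).cont
  have hzero : ∀ᵐ ω ∂P, ∀ i, B 0 ω i = 0 :=
    ae_all_iff.2 fun i => (hz.isBrownianMotion.isBrownianReal i).eval_zero_ae_eq_zero
  filter_upwards [hcont, hzero, hz.continuous, hz.sde] with ω hBc hB0 hzc hsde i
  have hzi : Continuous fun s : ℝ => z s.toNNReal ω i :=
    ((continuous_apply i).comp hzc).comp continuous_real_toNNReal
  have hBi : Continuous fun s : ℝ => √2 * B s.toNNReal ω i :=
    continuous_const.mul ((hBc i).comp continuous_real_toNNReal)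
  have h := eq_of_eq_sub_integral_add (x₀ := z 0 ω i) hzi hBi (fun s hs => by
    have := hsde s.toNNReal i
    rwa [Real.coe_toNNReal s hs] at this) t.coe_nonneg
  simp only [Real.toNNReal_coe] at h
  rw [h, ouNoise_eq (hBc i) (hB0 i)]
  simp_rw [mul_left_comm _ (√2)]
  rw [intervalIntegral.integral_const_mul]
  ring

variable [IsProbabilityMeasure P]

/-- `ouNoise t` is a measurable function of the whole path. Hence independence of the coordinates of
`B`, and of `z 0` from `B`, passes to the noise. -/
lemma hasLaw_prod (hz : IsOUProcess z B P) (t : ℝ≥0) :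
    HasLaw (fun ω => (z 0 ω, fun i => √2 * ouNoise t fun s => B s ω i))
      ((P.map (z 0)).prod (Measure.pi fun _ => gaussianReal 0 (ouVar t))) P := by
  have hnoise : HasLaw (fun ω i => √2 * ouNoise t fun s => B s ω i)
      (Measure.pi fun _ : Fin d => gaussianReal 0 (ouVar t)) P :=
    iIndepFun.hasLaw_pi
      (fun i => hasLaw_sqrt_two_mul_ouNoise (hz.isBrownianMotion.isBrownianReal i) t)
      (hz.isBrownianMotion.iIndepFun.comp (fun _ b => √2 * ouNoise t b)
        fun _ => (measurable_ouNoise t).const_mul _)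
  have := Measure.isProbabilityMeasure_map (hz.aemeasurable 0)
  refine (indepFun_iff_hasLaw_prodMk_prod ⟨hz.aemeasurable 0, rfl⟩ hnoise).1 ?_
  refine hz.indepFun.comp (φ := id)
    (ψ := fun (b : ℝ≥0 → Fin d → ℝ) i => √2 * ouNoise t fun s => b s i) measurable_id ?_
  exact measurable_pi_lambda _ fun i =>
    ((measurable_ouNoise t).comp (by fun_prop)).const_mul _

/-- The joint law of the initial value and the value at time `t`. -/
lemma hasLaw_zero_prodMk (hz : IsOUProcess z B P) (t : ℝ≥0) :
    HasLaw (fun ω => (z 0 ω, z t ω))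
      (((P.map (z 0)).prod (Measure.pi fun _ => gaussianReal 0 (ouVar t))).map
        fun p => (p.1, fun i => Real.exp (-t) * p.1 i + p.2 i)) P := by
  have h := hz.hasLaw_prod t
  refine HasLaw.congr (HasLaw.fun_comp ⟨by fun_prop, rfl⟩ h) ?_
  filter_upwards [hz.ae_eq t] with ω hω
  exact Prod.ext rfl (funext hω)

lemma hasLaw_eval (hz : IsOUProcess z B P) (hz₀ : ∀ i, HasLaw (fun ω => z 0 ω i) (gaussianReal 0 1) P)
    (t : ℝ≥0) (i : Fin d) : HasLaw (fun ω => z t ω i) (gaussianReal 0 1) P := by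
  have hnoise := hasLaw_sqrt_two_mul_ouNoise (hz.isBrownianMotion.isBrownianReal i) t
  have hstart := gaussianReal_const_mul (hz₀ i) (Real.exp (-t))
  have hind : IndepFun (fun ω => Real.exp (-t) * z 0 ω i)
      (fun ω => √2 * ouNoise t fun s => B s ω i) P :=
    hz.indepFun.comp (φ := fun x : Fin d → ℝ => Real.exp (-t) * x i)
      (ψ := fun b : ℝ≥0 → Fin d → ℝ => √2 * ouNoise t fun s => b s i) (by fun_prop)
      (((measurable_ouNoise t).comp (by fun_prop)).const_mul _)
  have hsum := gaussianReal_add_gaussianReal_of_indepFun hind hstart.map_eq hnoise.map_eq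
  have hvar : NNReal.mk (Real.exp (-t) ^ 2) (sq_nonneg _) * 1 + ouVar t = 1 := by
    ext
    push_cast
    rw [coe_ouVar, ← Real.exp_nat_mul]
    simp
  rw [hvar, mul_zero, add_zero] at hsum
  refine HasLaw.congr ⟨hstart.aemeasurable.add hnoise.aemeasurable, hsum⟩ ?_
  filter_upwards [hz.ae_eq t] with ω hω
  exact hω i

end IsOUProcess

/-! ### The standard normal distribution function and its inverse. -/

lemma ofReal_stdNormalCDF (x : ℝ) :
    ENNReal.ofReal (stdNormalCDF x) = gaussianReal 0 1 (Set.Iic x) :=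
  ofReal_cdf _ x

lemma stdNormalCDF_nonneg (x : ℝ) : 0 ≤ stdNormalCDF x := cdf_nonneg _ x

lemma gaussianReal_Ioo_pos {x y : ℝ} (hxy : x < y) : 0 < gaussianReal 0 1 (Set.Ioo x y) := by
  rw [pos_iff_ne_zero]
  intro h
  have := gaussianReal_absolutelyContinuous' 0 one_ne_zero h
  simp at this
  linarith

lemma strictMono_stdNormalCDF : StrictMono stdNormalCDF := by
  intro x y hxy
  have hlt : gaussianReal 0 1 (Set.Iic x) < gaussianReal 0 1 (Set.Iic y) := by
    rw [← Set.Iic_union_Ioc_eq_Iic hxy.le,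
      measure_union (Set.Iic_disjoint_Ioc le_rfl) measurableSet_Ioc]
    exact ENNReal.lt_add_right (measure_ne_top _ _)
      ((gaussianReal_Ioo_pos hxy).trans_le (measure_mono Set.Ioo_subset_Ioc_self)).ne'
  rw [← ofReal_stdNormalCDF, ← ofReal_stdNormalCDF] at hlt
  exact (ENNReal.ofReal_lt_ofReal_iff_of_nonneg (stdNormalCDF_nonneg x)).1 hlt

lemma measurable_stdNormalCDF : Measurable stdNormalCDF :=
  strictMono_stdNormalCDF.monotone.measurable

lemma stdNormalCDF_mem_Ioo (x : ℝ) : stdNormalCDF x ∈ Set.Ioo 0 1 :=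
  ⟨(stdNormalCDF_nonneg (x - 1)).trans_lt (strictMono_stdNormalCDF (by linarith)),
    (strictMono_stdNormalCDF (by linarith : x < x + 1)).trans_le (cdf_le_one _ _)⟩

/-- The Gaussian law has no atoms, so its distribution function has no jumps. -/
lemma continuous_stdNormalCDF : Continuous stdNormalCDF := by
  rw [continuous_iff_continuousAt]
  intro x
  have : NullSingletonClass (gaussianReal 0 1) := nullSingletonClass_gaussianReal one_ne_zero
  have h : (cdf (gaussianReal 0 1)).measure {x} = 0 := by
    rw [measure_cdf, measure_singleton]
  rw [StieltjesFunction.measure_singleton, ENNReal.ofReal_eq_zero, sub_nonpos] at h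
  have hmono : Monotone stdNormalCDF := strictMono_stdNormalCDF.monotone
  rw [hmono.continuousAt_iff_leftLim_eq_rightLim]
  exact le_antisymm (hmono.leftLim_le_rightLim le_rfl)
    (((cdf (gaussianReal 0 1)).rightLim_eq x).trans_le h)

lemma exists_stdNormalCDF_eq {u : ℝ} (hu : u ∈ Set.Ioo 0 1) : ∃ x, stdNormalCDF x = u := by
  obtain ⟨a, ha⟩ := ((tendsto_cdf_atBot (gaussianReal 0 1)).eventually_lt_const hu.1).exists
  obtain ⟨b, hb⟩ := ((tendsto_cdf_atTop (gaussianReal 0 1)).eventually_const_lt hu.2).exists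
  exact mem_range_of_exists_le_of_exists_ge continuous_stdNormalCDF ⟨a, ha.le⟩ ⟨b, hb.le⟩

lemma stdNormalQuantile_stdNormalCDF (x : ℝ) : stdNormalQuantile (stdNormalCDF x) = x := by
  have : {y | stdNormalCDF x ≤ stdNormalCDF y} = Set.Ici x := by
    ext y
    exact strictMono_stdNormalCDF.le_iff_le
  rw [stdNormalQuantile, this, csInf_Ici]

lemma stdNormalCDF_stdNormalQuantile {u : ℝ} (hu : u ∈ Set.Ioo 0 1) :
    stdNormalCDF (stdNormalQuantile u) = u := by
  obtain ⟨x, rfl⟩ := exists_stdNormalCDF_eq hu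
  rw [stdNormalQuantile_stdNormalCDF]

lemma stdNormalQuantile_le_iff {u : ℝ} (hu : u ∈ Set.Ioo 0 1) (x : ℝ) :
    stdNormalQuantile u ≤ x ↔ u ≤ stdNormalCDF x := by
  rw [← strictMono_stdNormalCDF.le_iff_le, stdNormalCDF_stdNormalQuantile hu]

instance isProbabilityMeasure_uniform01 : IsProbabilityMeasure uniform01 :=
  ⟨by simp [uniform01]⟩

lemma ae_uniform01_mem : ∀ᵐ u ∂uniform01, u ∈ Set.Ioo (0 : ℝ) 1 :=
  ae_restrict_mem measurableSet_Ioo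

lemma aemeasurable_stdNormalQuantile : AEMeasurable stdNormalQuantile uniform01 :=
  aemeasurable_restrict_of_monotoneOn measurableSet_Ioo fun u hu v hv huv => by
    rw [stdNormalQuantile_le_iff hu, stdNormalCDF_stdNormalQuantile hv]
    exact huv

/-- Inverse transform sampling. -/
lemma map_stdNormalQuantile_uniform01 : uniform01.map stdNormalQuantile = gaussianReal 0 1 := by
  have := Measure.isProbabilityMeasure_map aemeasurable_stdNormalQuantile
  refine Measure.ext_of_Iic _ _ fun x => ?_
  rw [Measure.map_apply_of_aemeasurable aemeasurable_stdNormalQuantile measurableSet_Iic]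
  have hset : stdNormalQuantile ⁻¹' Set.Iic x =ᵐ[uniform01] Set.Iic (stdNormalCDF x) := by
    filter_upwards [ae_uniform01_mem] with u hu
    exact propext (stdNormalQuantile_le_iff hu x)
  have hinter : Set.Iic (stdNormalCDF x) ∩ Set.Ioo 0 1 = Set.Ioc 0 (stdNormalCDF x) := by
    ext u
    have := (stdNormalCDF_mem_Ioo x).2
    simp only [Set.mem_inter_iff, Set.mem_Iic, Set.mem_Ioo, Set.mem_Ioc]
    exact ⟨fun h => ⟨h.2.1, h.1⟩, fun h => ⟨h.2, h.1, h.2.trans_lt this⟩⟩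
  rw [measure_congr hset, uniform01, Measure.restrict_apply measurableSet_Iic, hinter,
    Real.volume_Ioc, sub_zero, ofReal_stdNormalCDF]

lemma map_stdNormalCDF_gaussianReal : (gaussianReal 0 1).map stdNormalCDF = uniform01 := by
  rw [← map_stdNormalQuantile_uniform01, AEMeasurable.map_map_of_aemeasurable
    measurable_stdNormalCDF.aemeasurable aemeasurable_stdNormalQuantile]
  have : stdNormalCDF ∘ stdNormalQuantile =ᵐ[uniform01] id := by
    filter_upwards [ae_uniform01_mem] with u hu
    exact stdNormalCDF_stdNormalQuantile hu
  rw [Measure.map_congr this, Measure.map_id]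

/-! ### Copulas of laws with standard normal marginals. -/

/-- Finite measures on `ℝ^d` are determined by their joint distribution functions. -/
lemma ext_of_Iic_pi {d : ℕ} {μ ν : Measure (Fin d → ℝ)} [IsProbabilityMeasure μ]
    [IsProbabilityMeasure ν] (h : ∀ x, μ (Set.Iic x) = ν (Set.Iic x)) : μ = ν := by
  have hspan : IsCountablySpanning (Set.range (Set.Iic : ℝ → Set ℝ)) :=
    ⟨fun n => Set.Iic (n : ℝ), fun n => ⟨n, rfl⟩, Set.iUnion_eq_univ_iff.2 fun x => exists_nat_ge x⟩
  refine ext_of_generate_finite (Set.univ.pi '' Set.univ.pi fun _ => Set.range Set.Iic)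
    (generateFrom_eq_pi (fun _ => ?_) fun _ => hspan).symm
    (IsPiSystem.pi fun _ => isPiSystem_Iic) ?_ (by simp)
  · rw [← borel_eq_generateFrom_Iic, BorelSpace.measurable_eq (α := ℝ)]
  · rintro _ ⟨s, hs, rfl⟩
    choose x hx using fun i => hs i (Set.mem_univ i)
    obtain rfl : (fun i => Set.Iic (x i)) = s := funext hx
    rw [Set.pi_univ_Iic]
    exact h x

section CoordinateMap

variable {d : ℕ}

/-- The distribution function `Φ`, applied to every coordinate. -/
noncomputable def stdNormalCDFPi (x : Fin d → ℝ) : Fin d → ℝ := fun i => stdNormalCDF (x i)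

lemma measurable_stdNormalCDFPi : Measurable (stdNormalCDFPi (d := d)) :=
  measurable_pi_lambda _ fun i => measurable_stdNormalCDF.comp (measurable_pi_apply i)

lemma map_stdNormalCDFPi_pi_gaussianReal :
    (Measure.pi fun _ : Fin d => gaussianReal 0 1).map stdNormalCDFPi = independenceCopula d := by
  have : ∀ _ : Fin d, SigmaFinite ((gaussianReal 0 1).map stdNormalCDF) := fun _ => by
    rw [map_stdNormalCDF_gaussianReal]
    infer_instance
  have h := Measure.pi_map_pi (μ := fun _ : Fin d => gaussianReal 0 1)
    (f := fun _ => stdNormalCDF) fun _ => measurable_stdNormalCDF.aemeasurable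
  rw [map_stdNormalCDF_gaussianReal] at h
  exact h

section Copula

variable {μ C : Measure (Fin d → ℝ)} [IsProbabilityMeasure μ]

/-- Strict monotonicity of Φ makes the preimage of the orthant at Φ(x) the orthant at x. -/
lemma isCopulaOf_map_stdNormalCDFPi (hμ : ∀ i, μ.map (fun y => y i) = gaussianReal 0 1) :
    IsCopulaOf (μ.map stdNormalCDFPi) μ where
  isCopula :=
    { isProbabilityMeasure :=
        Measure.isProbabilityMeasure_map measurable_stdNormalCDFPi.aemeasurable
      map_eval := fun i => by
        rw [Measure.map_map (measurable_pi_apply i) measurable_stdNormalCDFPi,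
          ← map_stdNormalCDF_gaussianReal, ← hμ i,
          Measure.map_map measurable_stdNormalCDF (measurable_pi_apply i)]
        rfl }
  sklar := fun x => by
    rw [Measure.map_apply measurable_stdNormalCDFPi measurableSet_Iic]
    congr 1
    ext y
    simp only [hμ, Set.mem_preimage, Set.mem_Iic, Pi.le_def]
    exact forall_congr' fun i => strictMono_stdNormalCDF.le_iff_le.symm

/-- Sklar's identity says that the coordinatewise quantile transform carries `C` to `μ`. A copula
charges only the open cube, where Φ inverts that transform. -/
lemma IsCopulaOf.eq_map_stdNormalCDFPi (hμ : ∀ i, μ.map (fun y => y i) = gaussianReal 0 1)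
    (hC : IsCopulaOf C μ) : C = μ.map stdNormalCDFPi := by
  have := hC.isCopula.isProbabilityMeasure
  have hmem : ∀ᵐ u ∂C, ∀ i, u i ∈ Set.Ioo (0 : ℝ) 1 := ae_all_iff.2 fun i =>
    ae_of_ae_map (f := fun u : Fin d → ℝ => u i) (measurable_pi_apply i).aemeasurable
      (by rw [hC.isCopula.map_eval i]; exact ae_uniform01_mem)
  have hmeas : AEMeasurable (fun (u : Fin d → ℝ) i => stdNormalQuantile (u i)) C :=
    aemeasurable_pi_lambda _ fun i => AEMeasurable.comp_aemeasurable (g := stdNormalQuantile)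
      (f := fun u : Fin d → ℝ => u i) (by rw [hC.isCopula.map_eval i]; exact aemeasurable_stdNormalQuantile)
      (measurable_pi_apply i).aemeasurable
  have hμC : C.map (fun u i => stdNormalQuantile (u i)) = μ := by
    have := Measure.isProbabilityMeasure_map hmeas
    refine ext_of_Iic_pi fun x => ?_
    rw [Measure.map_apply_of_aemeasurable hmeas measurableSet_Iic, hC.sklar x]
    refine measure_congr ?_
    filter_upwards [hmem] with u hu
    refine propext (forall_congr' fun i => ?_)
    have h := stdNormalQuantile_le_iff (hu i) (x i)
    rw [stdNormalCDF, ← hμ i] at h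
    exact h
  rw [← hμC, AEMeasurable.map_map_of_aemeasurable measurable_stdNormalCDFPi.aemeasurable hmeas]
  have hid : stdNormalCDFPi ∘ (fun u i => stdNormalQuantile (u i)) =ᵐ[C] id := by
    filter_upwards [hmem] with u hu
    exact funext fun i => stdNormalCDF_stdNormalQuantile (hu i)
  rw [Measure.map_congr hid, Measure.map_id]

end Copula

end CoordinateMap

/-! ### Gaussian densities relative to the standard Gaussian. -/

/-- The density of `gaussianReal m v` with respect to `gaussianReal 0 1`. -/
noncomputable def gaussianRatio (m : ℝ) (v : ℝ≥0) (y : ℝ) : ℝ :=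
  gaussianPDFReal m v y / gaussianPDFReal 0 1 y

lemma measurable_gaussianRatio (v : ℝ≥0) :
    Measurable fun p : ℝ × ℝ => gaussianRatio p.1 v p.2 := by
  unfold gaussianRatio gaussianPDFReal
  fun_prop

lemma gaussianRatio_pos (m : ℝ) {v : ℝ≥0} (hv : v ≠ 0) (y : ℝ) : 0 < gaussianRatio m v y :=
  div_pos (gaussianPDFReal_pos _ _ _ hv) (gaussianPDFReal_pos _ _ _ one_ne_zero)

lemma log_gaussianRatio (m : ℝ) {v : ℝ≥0} (hv : v ≠ 0) (y : ℝ) :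
    Real.log (gaussianRatio m v y) =
      -(Real.log v / 2) - (y - m) ^ 2 / (2 * v) + y ^ 2 / 2 := by
  have hv0 : (0 : ℝ) < v := by positivity
  have hlog (m : ℝ) {v : ℝ≥0} (hv : v ≠ 0) : Real.log (gaussianPDFReal m v y) =
      -((Real.log (2 * Real.pi) + Real.log v) / 2) - (y - m) ^ 2 / (2 * v) := by
    have hv0 : (0 : ℝ) < v := by positivity
    rw [gaussianPDFReal_def, Real.log_mul (by positivity) (by positivity), Real.log_exp,
      Real.log_inv, Real.log_sqrt (by positivity), Real.log_mul (by positivity) hv0.ne']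
    ring
  rw [gaussianRatio, Real.log_div (gaussianPDFReal_pos _ _ _ hv).ne'
    (gaussianPDFReal_pos _ _ _ one_ne_zero).ne', hlog m hv, hlog 0 one_ne_zero]
  simp
  ring

lemma gaussianReal_eq_withDensity_gaussianRatio (m : ℝ) {v : ℝ≥0} (hv : v ≠ 0) :
    gaussianReal m v =
      (gaussianReal 0 1).withDensity fun y => ENNReal.ofReal (gaussianRatio m v y) := by
  have hmeas : Measurable fun y => ENNReal.ofReal (gaussianRatio m v y) :=
    ((measurable_gaussianRatio v).comp measurable_prodMk_left).ennreal_ofReal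
  rw [gaussianReal_of_var_ne_zero m hv, gaussianReal_of_var_ne_zero 0 one_ne_zero,
    ← withDensity_mul _ (measurable_gaussianPDF _ _) hmeas]
  congr 1
  ext y
  rw [Pi.mul_apply, gaussianPDF, gaussianPDF, ← ENNReal.ofReal_mul (gaussianPDFReal_nonneg _ _ _),
    gaussianRatio, mul_div_cancel₀ _ (gaussianPDFReal_pos _ _ _ one_ne_zero).ne']

/-- On a box the integrand is a product of functions of single coordinates, which are independent
under the product measure. -/
lemma pi_withDensity {ι : Type*} [Fintype ι] {X : ι → Type*} [∀ i, MeasurableSpace (X i)]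
    (μ : ∀ i, Measure (X i)) [∀ i, IsProbabilityMeasure (μ i)] {f : ∀ i, X i → ℝ≥0∞}
    (hf : ∀ i, Measurable (f i)) [∀ i, SigmaFinite ((μ i).withDensity (f i))] :
    Measure.pi (fun i => (μ i).withDensity (f i)) =
      (Measure.pi μ).withDensity fun x => ∏ i, f i (x i) := by
  refine Measure.pi_eq fun s hs => ?_
  have hmeas (i : ι) : Measurable ((s i).indicator (f i)) := (hf i).indicator (hs i)
  have hind := iIndepFun_pi (μ := μ) fun i => (hmeas i).aemeasurable
  have hprod := lintegral_prod_eq_prod_lintegral_of_indepFun Finset.univ _ hind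
    fun i => (hmeas i).comp (measurable_pi_apply i)
  rw [withDensity_apply _ (MeasurableSet.univ_pi hs), ← lintegral_indicator (.univ_pi hs)]
  calc _ = ∫⁻ x, ∏ i, (s i).indicator (f i) (x i) ∂Measure.pi μ := by
        refine lintegral_congr fun x => ?_
        by_cases hx : x ∈ Set.univ.pi s
        · rw [Set.indicator_of_mem hx]
          exact Finset.prod_congr rfl fun i _ =>
            (Set.indicator_of_mem (hx i (Set.mem_univ i)) (f i)).symm
        · rw [Set.indicator_of_notMem hx]
          obtain ⟨i, hi⟩ : ∃ i, x i ∉ s i := by simpa [Set.mem_pi] using hx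
          exact (Finset.prod_eq_zero (Finset.mem_univ i) (Set.indicator_of_notMem hi _)).symm
    _ = ∏ i, ∫⁻ x, (s i).indicator (f i) (x i) ∂Measure.pi μ := hprod
    _ = _ := by
        refine Finset.prod_congr rfl fun i _ => ?_
        rw [withDensity_apply _ (hs i), ← lintegral_indicator (hs i)]
        exact (measurePreserving_eval μ i).lintegral_comp (hmeas i)

section Joint

variable {d : ℕ}

/-- The density of the law of `(x, a x + √v G)` with respect to the law of `(x, G)`, where `G` is
a standard Gaussian vector independent of `x`. -/
noncomputable def jointDensity (d : ℕ) (a : ℝ) (v : ℝ≥0) (p : (Fin d → ℝ) × (Fin d → ℝ)) : ℝ :=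
  ∏ i, gaussianRatio (a * p.1 i) v (p.2 i)

lemma measurable_jointDensity (a : ℝ) (v : ℝ≥0) : Measurable (jointDensity d a v) := by
  refine Finset.measurable_fun_prod Finset.univ fun i _ => ?_
  have h : Measurable fun p : (Fin d → ℝ) × (Fin d → ℝ) => (a * p.1 i, p.2 i) := by fun_prop
  exact (measurable_gaussianRatio v).comp (f := fun p : (Fin d → ℝ) × (Fin d → ℝ) =>
    (a * p.1 i, p.2 i)) h

lemma jointDensity_pos (a : ℝ) {v : ℝ≥0} (hv : v ≠ 0) (p : (Fin d → ℝ) × (Fin d → ℝ)) :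
    0 < jointDensity d a v p :=
  Finset.prod_pos fun _ _ => gaussianRatio_pos _ hv _

lemma map_pi_gaussianReal_add_eq_withDensity (a : ℝ) {v : ℝ≥0} (hv : v ≠ 0) (x : Fin d → ℝ) :
    (Measure.pi fun _ : Fin d => gaussianReal 0 v).map (fun y i => a * x i + y i) =
      (Measure.pi fun _ : Fin d => gaussianReal 0 1).withDensity
        fun y => ENNReal.ofReal (jointDensity d a v (x, y)) := by
  have hshift (i : Fin d) : (gaussianReal 0 v).map (fun y => a * x i + y) =
      gaussianReal (a * x i) v := by
    rw [gaussianReal_map_const_add, zero_add]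
  have : ∀ i, SigmaFinite ((gaussianReal 0 v).map fun y => a * x i + y) := fun i => by
    rw [hshift]
    infer_instance
  have hratio := fun i => gaussianReal_eq_withDensity_gaussianRatio (a * x i) hv
  have : ∀ i, SigmaFinite ((gaussianReal 0 1).withDensity
      fun y => ENNReal.ofReal (gaussianRatio (a * x i) v y)) := fun i => by
    rw [← hratio]
    infer_instance
  rw [Measure.pi_map_pi (μ := fun _ : Fin d => gaussianReal 0 v)
    (f := fun i y => a * x i + y) fun i => by fun_prop]
  simp_rw [hshift, hratio]
  rw [pi_withDensity (fun _ : Fin d => gaussianReal 0 1)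
    (f := fun i y => ENNReal.ofReal (gaussianRatio (a * x i) v y)) fun i =>
    ((measurable_gaussianRatio v).comp measurable_prodMk_left).ennreal_ofReal]
  simp_rw [jointDensity, ENNReal.ofReal_prod_of_nonneg
    fun i _ => (gaussianRatio_pos (a * x i) hv _).le]

/-- Fubini reduces this to the fibre over each `x`, so nothing is asked of `μ` beyond being a
probability. -/
lemma map_prod_eq_withDensity (μ : Measure (Fin d → ℝ)) [IsProbabilityMeasure μ] (a : ℝ)
    {v : ℝ≥0} (hv : v ≠ 0) :
    (μ.prod (Measure.pi fun _ => gaussianReal 0 v)).map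
        (fun p => (p.1, fun i => a * p.1 i + p.2 i)) =
      (μ.prod (Measure.pi fun _ => gaussianReal 0 1)).withDensity
        fun p => ENNReal.ofReal (jointDensity d a v p) := by
  have hg := (measurable_jointDensity (d := d) a v).ennreal_ofReal
  refine Measure.ext_of_lintegral _ fun f hf => ?_
  have hf' : Measurable fun p : (Fin d → ℝ) × (Fin d → ℝ) =>
      f (p.1, fun i => a * p.1 i + p.2 i) := hf.comp (by fun_prop)
  rw [lintegral_map hf (by fun_prop), lintegral_prod _ hf'.aemeasurable,
    lintegral_withDensity_eq_lintegral_mul _ hg hf, lintegral_prod _ (hg.mul hf).aemeasurable]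
  refine lintegral_congr fun x => ?_
  have hfx : Measurable fun y => f (x, y) := hf.comp measurable_prodMk_left
  have hmap := lintegral_map (μ := Measure.pi fun _ : Fin d => gaussianReal 0 v) hfx
    (g := fun y i => a * x i + y i) (by fun_prop)
  refine hmap.symm.trans ?_
  have hgx : Measurable fun y => ENNReal.ofReal (jointDensity d a v (x, y)) :=
    hg.comp measurable_prodMk_left
  rw [map_pi_gaussianReal_add_eq_withDensity a hv x,
    lintegral_withDensity_eq_lintegral_mul _ hgx hfx]
  rfl

end Joint

lemma HasLaw.integral_sq_of_gaussianReal {Ω : Type*} [MeasurableSpace Ω] {P : Measure Ω}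
    {X : Ω → ℝ} {v : ℝ≥0} (hX : HasLaw X (gaussianReal 0 v) P) :
    Integrable (fun ω => X ω ^ 2) P ∧ ∫ ω, X ω ^ 2 ∂P = v := by
  refine ⟨hX.hasGaussianLaw.memLp_two.integrable_sq, ?_⟩
  rw [← variance_of_integral_eq_zero hX.aemeasurable
    (by rw [hX.integral_eq, integral_id_gaussianReal]), hX.variance_eq, variance_id_gaussianReal]

/-! ### Relative entropy of the pair and its decay. -/

namespace IsOUProcess

variable {d : ℕ} {Ω : Type*} [MeasurableSpace Ω] {P : Measure Ω} [IsProbabilityMeasure P]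
  {z B : ℝ≥0 → Ω → Fin d → ℝ}

/-- The mutual information between the values at time `0` and at time `t > 0`. -/
lemma klDiv_joint (hz : IsOUProcess z B P)
    (hz₀ : ∀ i, HasLaw (fun ω => z 0 ω i) (gaussianReal 0 1) P) {t : ℝ≥0} (ht : ouVar t ≠ 0) :
    InformationTheory.klDiv (P.map fun ω => (z 0 ω, z t ω))
        ((P.map (z 0)).prod (Measure.pi fun _ => gaussianReal 0 1)) =
      ENNReal.ofReal (-(d * Real.log (ouVar t) / 2)) := by
  have hμ₀ := Measure.isProbabilityMeasure_map (hz.aemeasurable 0)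
  have hlaw := hz.hasLaw_zero_prodMk t
  have hJ := hlaw.map_eq.trans (map_prod_eq_withDensity (P.map (z 0)) (Real.exp (-t)) ht)
  have hg := measurable_jointDensity (d := d) (Real.exp (-t)) (ouVar t)
  have hJprob := Measure.isProbabilityMeasure_map hlaw.aemeasurable
  set ν := (P.map (z 0)).prod (Measure.pi fun _ : Fin d => gaussianReal 0 1)
  have hac : (P.map fun ω => (z 0 ω, z t ω)) ≪ ν := by
    rw [hJ]
    exact withDensity_absolutelyContinuous _ _
  have hllr : llr (P.map fun ω => (z 0 ω, z t ω)) ν =ᵐ[P.map fun ω => (z 0 ω, z t ω)]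
      fun p => Real.log (jointDensity d (Real.exp (-t)) (ouVar t) p) := by
    -- The density is identified `ν`-a.e.; absolute continuity moves this to the joint law, under
    -- which the logarithm is integrated.
    have h := hac.ae_le (Measure.rnDeriv_withDensity ν hg.ennreal_ofReal)
    rw [← hJ] at h
    filter_upwards [h] with p hp
    rw [llr, hp, ENNReal.toReal_ofReal (jointDensity_pos _ ht p).le]
  have hlog : ∀ᵐ ω ∂P, Real.log (jointDensity d (Real.exp (-t)) (ouVar t) (z 0 ω, z t ω)) =
      ∑ i, (-(Real.log (ouVar t) / 2) -
        (√2 * ouNoise t fun s => B s ω i) ^ 2 / (2 * ouVar t) + z t ω i ^ 2 / 2) := by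
    filter_upwards [hz.ae_eq t] with ω hω
    rw [jointDensity, Real.log_prod fun i _ => (gaussianRatio_pos _ ht _).ne']
    refine Finset.sum_congr rfl fun i _ => ?_
    have h : z t ω i - Real.exp (-t) * z 0 ω i = √2 * ouNoise t fun s => B s ω i := by
      rw [hω i]
      ring
    rw [log_gaussianRatio _ ht]
    dsimp only
    rw [h]
  have hv : (ouVar t : ℝ) ≠ 0 := by exact_mod_cast ht
  have hN (i : Fin d) := HasLaw.integral_sq_of_gaussianReal
    (hasLaw_sqrt_two_mul_ouNoise (hz.isBrownianMotion.isBrownianReal i) t)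
  have hZ (i : Fin d) := HasLaw.integral_sq_of_gaussianReal (hz.hasLaw_eval hz₀ t i)
  have hdiff (i : Fin d) : Integrable (fun ω => -(Real.log (ouVar t) / 2) -
      (√2 * ouNoise t fun s => B s ω i) ^ 2 / (2 * ouVar t)) P :=
    (integrable_const _).sub ((hN i).1.div_const _)
  have hint (i : Fin d) : Integrable (fun ω => -(Real.log (ouVar t) / 2) -
      (√2 * ouNoise t fun s => B s ω i) ^ 2 / (2 * ouVar t) + z t ω i ^ 2 / 2) P :=
    (hdiff i).add ((hZ i).1.div_const _)
  -- With `v = ouVar t`, the second moments contribute `-v / (2 * v) + 1 / 2 = 0`; the unit variance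
  -- of `z t` makes them cancel.
  have hval (i : Fin d) : ∫ ω, (-(Real.log (ouVar t) / 2) -
      (√2 * ouNoise t fun s => B s ω i) ^ 2 / (2 * ouVar t) + z t ω i ^ 2 / 2) ∂P =
      -(Real.log (ouVar t) / 2) := by
    rw [integral_add (hdiff i) ((hZ i).1.div_const _),
      integral_sub (integrable_const _) ((hN i).1.div_const _), integral_div, integral_div,
      (hN i).2, (hZ i).2, integral_const, probReal_univ, one_smul]
    field_simp
    simp
  have hlogm : AEStronglyMeasurable
      (fun p => Real.log (jointDensity d (Real.exp (-t)) (ouVar t) p))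
      (P.map fun ω => (z 0 ω, z t ω)) := hg.log.aestronglyMeasurable
  rw [InformationTheory.klDiv_of_ac_of_integrable hac, integral_congr_ae hllr,
    integral_map hlaw.aemeasurable hlogm, integral_congr_ae hlog,
    integral_finsetSum _ fun i _ => hint i]
  -- The total-mass terms in `klDiv` cancel, both measures being probabilities.
  · simp_rw [hval]
    simp
    ring_nf
  · rw [integrable_congr hllr, integrable_map_measure hlogm hlaw.aemeasurable]
    exact (integrable_finsetSum _ fun i _ => hint i).congr (hlog.mono fun _ h => h.symm)

end IsOUProcess

namespace IsOUProcess

variable {d : ℕ} {Ω : Type*} [MeasurableSpace Ω] {P : Measure Ω} [IsProbabilityMeasure P]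
  {z B : ℝ≥0 → Ω → Fin d → ℝ}

/-- Data processing: forgetting the initial value and applying Φ cannot increase the divergence. -/
lemma klDiv_map_stdNormalCDFPi_le (hz : IsOUProcess z B P)
    (hz₀ : ∀ i, HasLaw (fun ω => z 0 ω i) (gaussianReal 0 1) P) {t : ℝ≥0}
    (ht : Real.exp (-2 * t) ≤ 1 / 2) :
    InformationTheory.klDiv ((P.map (z t)).map stdNormalCDFPi) (independenceCopula d) ≤
      ENNReal.ofReal (d * Real.exp (-2 * t)) := by
  have hvar : (1 : ℝ) / 2 ≤ ouVar t := by
    rw [coe_ouVar]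
    linarith
  have hvar0 : (0 : ℝ) < ouVar t := by linarith
  have hne : ouVar t ≠ 0 := fun h => by simp [h] at hvar0
  have hμ₀ := Measure.isProbabilityMeasure_map (hz.aemeasurable 0)
  have hpair : AEMeasurable (fun ω => (z 0 ω, z t ω)) P :=
    (hz.aemeasurable 0).prodMk (hz.aemeasurable t)
  have hJ := Measure.isProbabilityMeasure_map hpair
  have hg : Measurable fun p : (Fin d → ℝ) × (Fin d → ℝ) => stdNormalCDFPi p.2 :=
    measurable_stdNormalCDFPi.comp measurable_snd
  have hleft : (P.map (z t)).map stdNormalCDFPi =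
      (P.map fun ω => (z 0 ω, z t ω)).map fun p => stdNormalCDFPi p.2 := by
    rw [AEMeasurable.map_map_of_aemeasurable measurable_stdNormalCDFPi.aemeasurable
      (hz.aemeasurable t), AEMeasurable.map_map_of_aemeasurable hg.aemeasurable hpair]
    rfl
  have hright : independenceCopula d = ((P.map (z 0)).prod
      (Measure.pi fun _ => gaussianReal 0 1)).map fun p => stdNormalCDFPi p.2 := by
    rw [← map_stdNormalCDFPi_pi_gaussianReal]
    conv_lhs => rw [← Measure.snd_prod (μ := P.map (z 0))
      (ν := Measure.pi fun _ : Fin d => gaussianReal 0 1)]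
    rw [Measure.snd, Measure.map_map measurable_stdNormalCDFPi measurable_snd]
    rfl
  rw [hleft, hright]
  refine (InformationTheory.klDiv_map_le _ _ hg).trans ?_
  rw [hz.klDiv_joint hz₀ hne]
  refine ENNReal.ofReal_le_ofReal ?_
  have hlog := Real.one_sub_inv_le_log_of_pos hvar0
  -- Here `1 / v - 1 = exp (-2 t) / v` for `v = ouVar t ≥ 1 / 2`. Together with `-log v ≤ 1 / v -
  -- 1`, the factor `d / 2` turns this into the constant `d`.
  have hinv : (ouVar t : ℝ)⁻¹ - 1 ≤ 2 * Real.exp (-2 * t) := by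
    rw [sub_le_iff_le_add, inv_le_iff_one_le_mul₀ hvar0, coe_ouVar]
    nlinarith [Real.exp_pos (-2 * (t : ℝ))]
  have hd : (0 : ℝ) ≤ d := d.cast_nonneg
  nlinarith

end IsOUProcess

/-! ### Conclusion. -/

lemma tendsto_exp_neg_two_mul :
    Tendsto (fun t : ℝ≥0 => Real.exp (-2 * (t : ℝ))) atTop (𝓝 0) :=
  Real.tendsto_exp_atBot.comp
    ((NNReal.tendsto_coe_atTop.2 tendsto_id).const_mul_atTop_of_neg (by norm_num))

theorem proposition1 {d : ℕ} {Ω : Type*} [MeasurableSpace Ω] (P : Measure Ω)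
    [IsProbabilityMeasure P]
    -- copula scale data `u₀`, and the Ornstein-Uhlenbeck process started from `Φ⁻¹(u₀)`
    (u₀ : Ω → Fin d → ℝ) (hu₀_meas : AEMeasurable u₀ P) (hu₀ : IsCopula (P.map u₀))
    (z B : ℝ≥0 → Ω → Fin d → ℝ) (hz : IsOUProcess z B P)
    (hz₀ : ∀ᵐ ω ∂P, ∀ i, z 0 ω i = stdNormalQuantile (u₀ ω i)) :
    -- every coordinate `Φ(z_t^i)` is uniform on `(0, 1)` at all times
    (∀ (t : ℝ≥0) (i : Fin d), HasLaw (fun ω => stdNormalCDF (z t ω i)) uniform01 P) ∧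
    -- the law of `z_t` has one and only one copula, at all times
    (∀ t : ℝ≥0, ∃! C : Measure (Fin d → ℝ), IsCopulaOf C (P.map (z t))) ∧
    -- the copula `c t` of `z_t` converges to independence, at rate `O(exp (-2 t))`
    (∀ c : ℝ≥0 → Measure (Fin d → ℝ), (∀ t, IsCopulaOf (c t) (P.map (z t))) →
      Tendsto (fun t => InformationTheory.klDiv (c t) (independenceCopula d)) atTop (𝓝 0) ∧
      ∃ K : ℝ, ∀ᶠ t : ℝ≥0 in atTop,
        InformationTheory.klDiv (c t) (independenceCopula d) ≤
          ENNReal.ofReal (K * Real.exp (-2 * (t : ℝ)))) := by 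
  have hz₀_law (i : Fin d) : HasLaw (fun ω => z 0 ω i) (gaussianReal 0 1) P := by
    have hu : HasLaw (fun ω => u₀ ω i) uniform01 P :=
      ⟨hu₀_meas.eval i, by
        rw [← hu₀.map_eval i, AEMeasurable.map_map_of_aemeasurable
          (measurable_pi_apply i).aemeasurable hu₀_meas]
        rfl⟩
    refine (HasLaw.fun_comp ⟨aemeasurable_stdNormalQuantile, map_stdNormalQuantile_uniform01⟩
      hu).congr ?_
    filter_upwards [hz₀] with ω hω using hω i
  have hlaw := hz.hasLaw_eval hz₀_law
  have hprob (t : ℝ≥0) := Measure.isProbabilityMeasure_map (hz.aemeasurable t)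
  have hmarg (t : ℝ≥0) (i : Fin d) : (P.map (z t)).map (fun y => y i) = gaussianReal 0 1 := by
    rw [AEMeasurable.map_map_of_aemeasurable (measurable_pi_apply i).aemeasurable
      (hz.aemeasurable t)]
    exact (hlaw t i).map_eq
  refine ⟨fun t i => HasLaw.fun_comp
    ⟨measurable_stdNormalCDF.aemeasurable, map_stdNormalCDF_gaussianReal⟩ (hlaw t i),
    fun t => ⟨_, isCopulaOf_map_stdNormalCDFPi (hmarg t),
      fun C hC => hC.eq_map_stdNormalCDFPi (hmarg t)⟩, fun c hc => ?_⟩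
  have hbound : ∀ᶠ t : ℝ≥0 in atTop, InformationTheory.klDiv (c t) (independenceCopula d) ≤
      ENNReal.ofReal (d * Real.exp (-2 * (t : ℝ))) := by
    filter_upwards [tendsto_exp_neg_two_mul.eventually_le_const one_half_pos] with t ht
    rw [(hc t).eq_map_stdNormalCDFPi (hmarg t)]
    exact hz.klDiv_map_stdNormalCDFPi_le hz₀_law ht
  refine ⟨tendsto_of_tendsto_of_tendsto_of_le_of_le' tendsto_const_nhds ?_
    (Eventually.of_forall fun _ => zero_le) hbound, d, hbound⟩
  have h := ENNReal.tendsto_ofReal (tendsto_exp_neg_two_mul.const_mul (d : ℝ))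
  rwa [mul_zero, ENNReal.ofReal_zero] at h
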